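/- Let $k$ be a field and let $H$ be a Hopf algebra over $k$ with bijective antipode. Let ${}^H_H\mathcal{YD}$ be the category of finite-dimensional left Yetter–Drinfeld modules over $H$: an object is a finite-dimensional left $H$-module and left $H$-comodule $M$, with coaction $m\mapsto m_{(-1)}\otimes m_{(0)}$, such that $$(hm)_{(-1)}\otimes (hm)_{(0)}=h_{(1)}m_{(-1)}\mathcal S(h_{(3)})\otimes h_{(2)}m_{(0)}\qquad (h\in H,\ m\in M);$$ it is a braided monoidal category under $\otimes_k$, with the diagonal action and coaction and with the braiding $c(m\otimes n)=m_{(-1)}n\otimes m_{(0)}$. Let $R$ be a graded Hopf algebra in ${}^H_H\mathcal{YD}$, that is, a Hopf algebra in this braided category together with a decomposition $R=\bigoplus_{n\ge 0}R(n)$ into Yetter–Drinfeld submodules such that $$R(i)R(j)\subseteq R(i+j),\qquad \Delta(R(n))\subseteq\bigoplus_{i+j=n}R(i)\otimes R(j)\qquad\text{for all } i,j,n\ge 0.$$ Let $N\ge 0$ be such that $R(N)\neq 0$ and $R(i)=0$ for all $i>N$, so that $R=\bigoplus_{i=0}^N R(i)$. Then $$\dim_k R(i)=\dim_k R(N-i)\qquad\text{for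 all } 0\le i\le N.$$ -/

import Mathlib

open scoped TensorProduct

/-- A (left) action and a (left) coaction of `H` on the `k`-vector space `M`. The action is a
representation of the algebra `H`; the laws for the coaction are in `IsYetterDrinfeld`. -/
structure ActionCoaction (k H M : Type*) [Field k] [Ring H] [HopfAlgebra k H]
    [AddCommGroup M] [Module k M] where
  /-- The action: `act h m` is `h m`. -/
  act : H →ₐ[k] Module.End k M
  /-- The coaction `m ↦ m₍₋₁₎ ⊗ m₍₀₎`. -/
  coact : M →ₗ[k] H ⊗[k] M

namespace ActionCoaction

noncomputable section

variable {k H M N P : Type*} [Field k] [Ring H] [HopfAlgebra k H]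
  [AddCommGroup M] [Module k M] [AddCommGroup N] [Module k N] [AddCommGroup P] [Module k P]

/-- The map `a ⊗ c ↦ (x ↦ a x S(c))`. -/
def sandwich (k H : Type*) [Field k] [Ring H] [HopfAlgebra k H] :
    H ⊗[k] H →ₗ[k] Module.End k H :=
  TensorProduct.lift ((LinearMap.mul k (Module.End k H)).compl₁₂ (LinearMap.mul k H)
    ((LinearMap.mul k H).flip ∘ₗ HopfAlgebra.antipode k))

/-- The map `a ⊗ (b ⊗ c) ↦ (x ⊗ m ↦ a x S(c) ⊗ b m)`. -/
def twist (V : ActionCoaction k H M) :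
    H ⊗[k] (H ⊗[k] H) →ₗ[k] Module.End k (H ⊗[k] M) :=
  TensorProduct.homTensorHomMap (.id k) H M H M ∘ₗ
    TensorProduct.map (sandwich k H) V.act.toLinearMap ∘ₗ
    (TensorProduct.assoc k H H H).symm.toLinearMap ∘ₗ
    (TensorProduct.comm k H H).toLinearMap.lTensor H

theorem twist_tmul (V : ActionCoaction k H M) (a b c x : H) (m : M) :
    V.twist (a ⊗ₜ (b ⊗ₜ c)) (x ⊗ₜ m) =
      (a * x * HopfAlgebra.antipode k c) ⊗ₜ[k] V.act b m := by
  simp [twist, sandwich, mul_assoc]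

/-- `M` is a left Yetter-Drinfeld module over `H`: it is a left `H`-module, a left `H`-comodule,
and `(h m)₍₋₁₎ ⊗ (h m)₍₀₎ = h₍₁₎ m₍₋₁₎ S(h₍₃₎) ⊗ h₍₂₎ m₍₀₎`. -/
structure IsYetterDrinfeld (V : ActionCoaction k H M) : Prop where
  coassoc : TensorProduct.assoc k H H M ∘ₗ (Coalgebra.comul (R := k)).rTensor M ∘ₗ V.coact =
    V.coact.lTensor H ∘ₗ V.coact
  counit_coact : (Coalgebra.counit (R := k)).rTensor M ∘ₗ V.coact = TensorProduct.mk k k M 1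
  coact_act : ∀ (h : H) (m : M), V.coact (V.act h m) =
    V.twist ((Coalgebra.comul (R := k)).lTensor H (Coalgebra.comul (R := k) h)) (V.coact m)

/-- The unit object `k`: `h` acts by `ε(h)`, and the coaction is `1 ↦ 1 ⊗ 1`. -/
def unit (k H : Type*) [Field k] [Ring H] [HopfAlgebra k H] : ActionCoaction k H k where
  act := (Algebra.ofId k (Module.End k k)).comp (Bialgebra.counitAlgHom k H)
  coact := TensorProduct.mk k H k 1

/-- The tensor product, with `h (m ⊗ n) = h₍₁₎ m ⊗ h₍₂₎ n` and
`m ⊗ n ↦ m₍₋₁₎ n₍₋₁₎ ⊗ (m₍₀₎ ⊗ n₍₀₎)`. -/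
def tensor (V : ActionCoaction k H M) (W : ActionCoaction k H N) :
    ActionCoaction k H (M ⊗[k] N) where
  act := Module.endTensorEndAlgHom.comp
    ((Algebra.TensorProduct.map V.act W.act).comp (Bialgebra.comulAlgHom k H))
  coact := (LinearMap.mul' k H).rTensor (M ⊗[k] N) ∘ₗ
    (TensorProduct.tensorTensorTensorComm k H M H N).toLinearMap ∘ₗ
    TensorProduct.map V.coact W.coact

/-- `f` is a morphism of Yetter-Drinfeld modules: `H`-linear and `H`-colinear. -/
structure IsHom (V : ActionCoaction k H M) (W : ActionCoaction k H N) (f : M →ₗ[k] N) :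
    Prop where
  map_act : ∀ h : H, f ∘ₗ V.act h = W.act h ∘ₗ f
  map_coact : W.coact ∘ₗ f = f.lTensor H ∘ₗ V.coact

/-- The action as a linear map `H ⊗ M → M`. -/
def actLin (V : ActionCoaction k H M) : H ⊗[k] M →ₗ[k] M :=
  TensorProduct.lift V.act.toLinearMap

/-- The braiding `m ⊗ n ↦ m₍₋₁₎ n ⊗ m₍₀₎`. -/
def braiding (V : ActionCoaction k H M) (W : ActionCoaction k H N) :
    M ⊗[k] N →ₗ[k] N ⊗[k] M :=
  W.actLin.rTensor M ∘ₗ (TensorProduct.rightComm k H M N).toLinearMap ∘ₗ V.coact.rTensor N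

/-- The map `id ⊗ c ⊗ id` on `M ⊗ M ⊗ M ⊗ M`, with `c` the braiding of `M` with itself. -/
def midBraiding (V : ActionCoaction k H M) :
    (M ⊗[k] M) ⊗[k] (M ⊗[k] M) →ₗ[k] (M ⊗[k] M) ⊗[k] (M ⊗[k] M) :=
  (TensorProduct.assoc k M M (M ⊗[k] M)).symm.toLinearMap ∘ₗ
    ((TensorProduct.assoc k M M M).toLinearMap ∘ₗ (V.braiding V).rTensor M ∘ₗ
      (TensorProduct.assoc k M M M).symm.toLinearMap).lTensor M ∘ₗ
    (TensorProduct.assoc k M M (M ⊗[k] M)).toLinearMap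

variable {R : Type*} [Ring R] [Algebra k R] [Coalgebra k R]

/-- The algebra and coalgebra `R` over `k`, with the given action and coaction of `H`, is a Hopf
algebra in the braided category of Yetter-Drinfeld modules over `H`. -/
structure IsHopfAlgebra (V : ActionCoaction k H R) : Prop where
  isYetterDrinfeld : V.IsYetterDrinfeld
  -- the four structure maps are morphisms of Yetter-Drinfeld modules
  isHom_mul : (V.tensor V).IsHom V (LinearMap.mul' k R)
  isHom_unit : (unit k H).IsHom V (Algebra.linearMap k R)
  isHom_comul : V.IsHom (V.tensor V) (Coalgebra.comul (R := k))
  isHom_counit : V.IsHom (unit k H) (Coalgebra.counit (R := k))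
  -- the counit is a morphism of algebras
  counit_one : Coalgebra.counit (R := k) (1 : R) = 1
  counit_mul : ∀ x y : R, Coalgebra.counit (R := k) (x * y) =
    Coalgebra.counit (R := k) x * Coalgebra.counit (R := k) y
  -- the comultiplication is a morphism of algebras to the braided tensor square
  comul_one : Coalgebra.comul (R := k) (1 : R) = 1 ⊗ₜ[k] 1
  comul_mul : Coalgebra.comul (R := k) ∘ₗ LinearMap.mul' k R =
    TensorProduct.map (LinearMap.mul' k R) (LinearMap.mul' k R) ∘ₗ V.midBraiding ∘ₗ
      TensorProduct.map (Coalgebra.comul (R := k)) (Coalgebra.comul (R := k))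
  -- there is an antipode
  exists_antipode : ∃ S : R →ₗ[k] R, V.IsHom V S ∧
    LinearMap.mul' k R ∘ₗ S.rTensor R ∘ₗ Coalgebra.comul (R := k) =
      Algebra.linearMap k R ∘ₗ Coalgebra.counit (R := k) ∧
    LinearMap.mul' k R ∘ₗ S.lTensor R ∘ₗ Coalgebra.comul (R := k) =
      Algebra.linearMap k R ∘ₗ Coalgebra.counit (R := k)

/-- `R` is a graded Hopf algebra in the category of Yetter-Drinfeld modules over `H`, with
homogeneous components `𝒜 0, 𝒜 1, 𝒜 2, …`. -/
structure IsGradedHopfAlgebra (V : ActionCoaction k H R) (𝒜 : ℕ → Submodule k R) : Prop where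
  isHopfAlgebra : V.IsHopfAlgebra
  -- `R` is the direct sum of the Yetter-Drinfeld submodules `𝒜 n`
  isInternal : DirectSum.IsInternal 𝒜
  act_mem : ∀ (n : ℕ) (h : H), ∀ x ∈ 𝒜 n, V.act h x ∈ 𝒜 n
  coact_mem : ∀ n : ℕ, ∀ x ∈ 𝒜 n, V.coact x ∈ LinearMap.range ((𝒜 n).subtype.lTensor H)
  mul_mem : ∀ i j : ℕ, ∀ x ∈ 𝒜 i, ∀ y ∈ 𝒜 j, x * y ∈ 𝒜 (i + j)
  comul_mem : ∀ n : ℕ, ∀ x ∈ 𝒜 n, Coalgebra.comul (R := k) x ∈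
    ⨆ p ∈ Finset.HasAntidiagonal.antidiagonal n, LinearMap.range (TensorProduct.mapIncl (𝒜 p.1) (𝒜 p.2))

end

end ActionCoaction

/-!
The argument is that of Larson and Sweedler for finite-dimensional Hopf algebras, carried out in
the braided category. The antipode of the bosonization of `R` by `H` lets `y ∈ R` act on `R` by
`x ↦ S(y₍₋₁₎) (S(y₍₀₎) x)`. This turns products around, so that it is contragredient to an action of
`R` on `R*`, and with that action `R*` is a Hopf module over `R`, whose coinvariants are the
integrals `f`, those with `f(x₍₁₎) x₍₂₎ = f(x) 1`.

For a Hopf module `M` over `R`, the shear `y ⊗ m ↦ y₍₁₎ ⊗ y₍₂₎ m` of `R ⊗ M` is bijective because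
`R` has an antipode. It follows that `M` has a nonzero coinvariant, and that no nonzero element of
`R` kills a nonzero coinvariant. Hence there is an integral `f ≠ 0`, and the pairing
`(y, x) ↦ f(S(y₍₋₁₎) (S(y₍₀₎) x))` has no nonzero `y` in its left kernel.

The homogeneous components of an integral are integrals, so `f` may be taken homogeneous of some
degree `d`. The antipode preserves degrees, so `R(i)` pairs to zero with `R(j)` unless `i + j = d`.
Thus `R(i)` embeds into the dual of `R(d - i)` for `i ≤ d` and vanishes for `i > d`. As `f` is
nonzero on `R(d)`, this gives `d = N`, and the two inequalities `dim R(i) ≤ dim R(N - i)` and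
`dim R(N - i) ≤ dim R(i)`.
-/

noncomputable section

open Coalgebra WithConv

section Convolution

variable {k C X A N : Type*} [CommSemiring k] [AddCommMonoid C] [Module k C] [AddCommMonoid X]
  [Module k X] [Semiring A] [Algebra k A] [AddCommMonoid N] [Module k N] [Module A N]
  [IsScalarTower k A N]

/-- The convolution `x ↦ F(x₍₋₁₎) • G(x₍₀₎)` along a map `δ : x ↦ x₍₋₁₎ ⊗ x₍₀₎`. If `δ` is a
coaction, this is an action of the convolution algebra of maps `C → A` on the maps `X → N`. -/
def convSMul (δ : X →ₗ[k] C ⊗[k] X) (F : C →ₗ[k] A) (G : X →ₗ[k] N) : X →ₗ[k] N :=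
  TensorProduct.lift ((Algebra.lsmul k k N).toLinearMap.compl₁₂ F G) ∘ₗ δ

theorem convSMul_apply_of_eq_sum {δ : X →ₗ[k] C ⊗[k] X} {F : C →ₗ[k] A} {G : X →ₗ[k] N} {x : X}
    {ι : Type*} {s : Finset ι} {c : ι → C} {y : ι → X} (hx : δ x = ∑ i ∈ s, c i ⊗ₜ y i) :
    convSMul δ F G x = ∑ i ∈ s, F (c i) • G (y i) := by
  simp [convSMul, hx]

theorem map_convSMul {δ : X →ₗ[k] C ⊗[k] X} {A' P : Type*} [Semiring A'] [Algebra k A']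
    [AddCommMonoid P] [Module k P] [Module A' P] [IsScalarTower k A' P]
    {F : C →ₗ[k] A} {G : X →ₗ[k] N} {F' : C →ₗ[k] A'} {G' : X →ₗ[k] P} (φ : N →ₗ[k] P)
    (h : ∀ c x, φ (F c • G x) = F' c • G' x) (x : X) :
    φ (convSMul δ F G x) = convSMul δ F' G' x := by
  obtain ⟨s, hs⟩ := TensorProduct.exists_finset (δ x)
  simp [convSMul_apply_of_eq_sum hs, h]

theorem convSMul_apply_apply (δ : X →ₗ[k] C ⊗[k] X) (F : C →ₗ[k] Module.End k N)
    (G : X →ₗ[k] Module.End k N) (x : X) (n : N) :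
    convSMul δ F G x n = convSMul δ F (G.flip n) x :=
  map_convSMul (LinearMap.applyₗ n) (fun _ _ => rfl) x

theorem convSMul_comp_of_colinear {δ : X →ₗ[k] C ⊗[k] X} {Y : Type*} [AddCommMonoid Y] [Module k Y]
    {δ' : Y →ₗ[k] C ⊗[k] Y} {f : Y →ₗ[k] X} (hf : δ ∘ₗ f = f.lTensor C ∘ₗ δ')
    (F : C →ₗ[k] A) (G : X →ₗ[k] N) :
    convSMul δ F G ∘ₗ f = convSMul δ' F (G ∘ₗ f) := by
  rw [convSMul, convSMul, LinearMap.comp_assoc, hf, ← LinearMap.comp_assoc]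
  congr 1
  ext c x
  simp

theorem commute_convSMul {δ : X →ₗ[k] C ⊗[k] X} {F : C →ₗ[k] A} {G : X →ₗ[k] A} {a : A}
    (hF : ∀ c, Commute a (F c)) (hG : ∀ x, Commute a (G x)) (x : X) :
    Commute a (convSMul δ F G x) := by
  obtain ⟨s, hs⟩ := TensorProduct.exists_finset (δ x)
  rw [convSMul_apply_of_eq_sum hs]
  exact Commute.sum_right _ _ _ fun i _ => (hF i.1).mul_right (hG i.2)

end Convolution

section Comodule

variable {k C X A N : Type*} [CommSemiring k] [AddCommMonoid C] [Module k C] [Coalgebra k C]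
  [AddCommMonoid X] [Module k X] [Semiring A] [Algebra k A] [AddCommMonoid N] [Module k N]
  [Module A N] [IsScalarTower k A N]

/-- `δ` is a left coaction of the coalgebra `C` on `X`. -/
structure IsLeftComodule (δ : X →ₗ[k] C ⊗[k] X) : Prop where
  coassoc : TensorProduct.assoc k C C X ∘ₗ (comul (R := k)).rTensor X ∘ₗ δ = δ.lTensor C ∘ₗ δ
  counit_coact : (counit (R := k)).rTensor X ∘ₗ δ = TensorProduct.mk k k X 1

variable (k C) in
theorem isLeftComodule_comul : IsLeftComodule (comul (R := k) (A := C)) where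
  coassoc := by ext; simp
  counit_coact := rTensor_counit_comp_comul

theorem convSMul_comul (F G : C →ₗ[k] A) :
    convSMul comul F G = (toConv F * toConv G).ofConv := by
  ext c
  simp [(ℛ k c).convMul_apply, convSMul_apply_of_eq_sum (ℛ k c).eq.symm]

theorem convSMul_comul_counit (F : C →ₗ[k] A) (n : N) :
    convSMul comul F ((counit (R := k)).smulRight n) = F.smulRight n := by
  ext c
  have hc : ∑ i ∈ (ℛ k c).index, counit (R := k) ((ℛ k c).right i) • (ℛ k c).left i = c := by
    have h := congr(TensorProduct.rid k C $(sum_tmul_counit_eq (ℛ k c)))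
    simpa only [map_sum, TensorProduct.rid_tmul, one_smul] using h
  rw [convSMul_apply_of_eq_sum (ℛ k c).eq.symm, LinearMap.smulRight_apply]
  conv_rhs => rw [← hc]
  simp only [LinearMap.smulRight_apply, smul_comm (F _), map_sum, map_smul, Finset.sum_smul,
    smul_assoc]

namespace IsLeftComodule

variable {δ : X →ₗ[k] C ⊗[k] X}

theorem convSMul_convSMul (hδ : IsLeftComodule δ) (F F' : C →ₗ[k] A) (G : X →ₗ[k] N) :
    convSMul δ F (convSMul δ F' G) = convSMul δ (toConv F * toConv F').ofConv G := by
  let Θ : C ⊗[k] (C ⊗[k] X) →ₗ[k] N :=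
    TensorProduct.lift ((Algebra.lsmul k k N).toLinearMap.compl₁₂ F
      (TensorProduct.lift ((Algebra.lsmul k k N).toLinearMap.compl₁₂ F' G)))
  have hr : convSMul δ F (convSMul δ F' G) = Θ ∘ₗ δ.lTensor C ∘ₗ δ := by
    rw [convSMul, ← LinearMap.comp_assoc]
    congr 1
    ext c x
    simp [Θ, convSMul]
  rw [hr, ← hδ.coassoc, convSMul, ← LinearMap.comp_assoc, ← LinearMap.comp_assoc]
  congr 1
  ext c x
  simp [Θ, ← (ℛ k c).eq, TensorProduct.sum_tmul]

theorem counit_convSMul (hδ : IsLeftComodule δ) (G : X →ₗ[k] N) :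
    convSMul δ (counit (R := k)) G = G := by
  have h : TensorProduct.lift ((Algebra.lsmul k k N).toLinearMap.compl₁₂ (counit (R := k)) G) =
      G ∘ₗ (TensorProduct.lid k X).toLinearMap ∘ₗ (counit (R := k) (A := C)).rTensor X := by
    ext c x
    simp
  rw [convSMul, h, LinearMap.comp_assoc, LinearMap.comp_assoc, hδ.counit_coact]
  ext x
  simp

theorem one_convSMul (hδ : IsLeftComodule δ) (G : X →ₗ[k] N) :
    convSMul δ (1 : WithConv (C →ₗ[k] A)).ofConv G = G := by
  conv_rhs => rw [← hδ.counit_convSMul G]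
  ext x
  exact map_convSMul .id (fun _ _ => by simp [LinearMap.convOne_def]) x

theorem convSMul_convSMul_of_mul_eq_one (hδ : IsLeftComodule δ) {F F' : C →ₗ[k] A}
    (h : toConv F * toConv F' = 1) (G : X →ₗ[k] N) : convSMul δ F (convSMul δ F' G) = G := by
  rw [hδ.convSMul_convSMul, h, hδ.one_convSMul]

theorem injective (hδ : IsLeftComodule δ) : Function.Injective δ := by
  refine Function.LeftInverse.injective (g := TensorProduct.lid k X ∘ (counit (R := k)).rTensor X)
    fun x => ?_
  simpa using congr(TensorProduct.lid k X ($hδ.counit_coact x))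

end IsLeftComodule

end Comodule

section Antipode

variable {k C A : Type*} [CommSemiring k] [Semiring C] [Algebra k C] [Coalgebra k C] [Semiring A]
  [Algebra k A] {S : C →ₗ[k] C}

theorem algHom_comp_mul_algHom (hS : toConv S * toConv .id = 1) (f : C →ₐ[k] A) :
    toConv (f.toLinearMap ∘ₗ S) * toConv f.toLinearMap = 1 := by
  have h := LinearMap.algHom_comp_convMul_distrib f (toConv S) (toConv .id)
  rw [hS] at h
  refine WithConv.ofConv_injective (h.symm.trans ?_)
  ext c
  simp [LinearMap.convOne_def]

theorem algHom_mul_algHom_comp (hS : toConv .id * toConv S = 1) (f : C →ₐ[k] A) :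
    toConv f.toLinearMap * toConv (f.toLinearMap ∘ₗ S) = 1 := by
  have h := LinearMap.algHom_comp_convMul_distrib f (toConv .id) (toConv S)
  rw [hS] at h
  refine WithConv.ofConv_injective (h.symm.trans ?_)
  ext c
  simp [LinearMap.convOne_def]

end Antipode

section Shear

variable {k C X Y : Type*} [CommSemiring k] [AddCommMonoid C] [Module k C] [Coalgebra k C]
  [AddCommMonoid X] [Module k X] [AddCommMonoid Y] [Module k Y]

/-- The map `c ⊗ x ↦ c₍₁₎ ⊗ β(c₍₂₎) x`. It is multiplicative in `β` with respect to convolution, and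
so it is bijective if `β` has a convolution inverse. -/
def shear (β : C →ₗ[k] Module.End k X) : C ⊗[k] X →ₗ[k] C ⊗[k] X :=
  (TensorProduct.lift β).lTensor C ∘ₗ (TensorProduct.assoc k C C X).toLinearMap ∘ₗ
    (comul (R := k)).rTensor X

theorem shear_tmul (β : C →ₗ[k] Module.End k X) (c : C) (x : X) :
    shear β (c ⊗ₜ x) = (β.flip x).lTensor C (comul c) := by
  simp [shear, ← (ℛ k c).eq, TensorProduct.sum_tmul]

theorem shear_one : shear (1 : WithConv (C →ₗ[k] Module.End k X)).ofConv = .id := by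
  ext c x
  have h : ((1 : WithConv (C →ₗ[k] Module.End k X)).ofConv.flip x).lTensor C (comul c) =
      (LinearMap.toSpanSingleton k X x).lTensor C ((counit (R := k)).lTensor C (comul c)) := by
    rw [← LinearMap.lTensor_comp_apply]
    rfl
  simp [shear_tmul, h]

theorem shear_mul (β γ : C →ₗ[k] Module.End k X) :
    shear (toConv β * toConv γ).ofConv = shear β ∘ₗ shear γ := by
  ext c x
  let Θ : C ⊗[k] (C ⊗[k] C) →ₗ[k] C ⊗[k] X := (TensorProduct.lift (β.compl₂ (γ.flip x))).lTensor C
  have hl : ((toConv β * toConv γ).ofConv.flip x).lTensor C = Θ ∘ₗ (comul (R := k)).lTensor C := by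
    rw [← LinearMap.lTensor_comp]
    congr 1
    ext b
    simp [(ℛ k b).convMul_apply, ← (ℛ k b).eq]
  have hr : shear β ∘ₗ (γ.flip x).lTensor C =
      Θ ∘ₗ (TensorProduct.assoc k C C C).toLinearMap ∘ₗ (comul (R := k)).rTensor C := by
    ext a b
    simp [Θ, shear_tmul, ← (ℛ k a).eq, TensorProduct.sum_tmul]
  have hΘ : Θ _ = Θ _ := congr(Θ $(coassoc_apply (R := k) c))
  simpa [shear_tmul, hl] using hΘ.symm.trans congr($hr (comul c)).symm

theorem shear_bijective {β γ : C →ₗ[k] Module.End k X} (hl : toConv γ * toConv β = 1)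
    (hr : toConv β * toConv γ = 1) : Function.Bijective (shear β) := by
  refine Function.bijective_iff_has_inverse.2 ⟨shear γ, fun w => ?_, fun w => ?_⟩
  · rw [← LinearMap.comp_apply, ← shear_mul, hl, shear_one, LinearMap.id_apply]
  · rw [← LinearMap.comp_apply, ← shear_mul, hr, shear_one, LinearMap.id_apply]

theorem lTensor_comp_shear {β : C →ₗ[k] Module.End k X} {β' : C →ₗ[k] Module.End k Y}
    {φ : X →ₗ[k] Y} (h : ∀ c x, φ (β c x) = β' c (φ x)) :
    φ.lTensor C ∘ₗ shear β = shear β' ∘ₗ φ.lTensor C := by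
  ext c x
  simp [shear_tmul, ← (ℛ k c).eq, h]

end Shear

section TensorFactors

variable {k B X M : Type*} [CommSemiring k] [Semiring B] [Algebra k B] [AddCommMonoid X]
  [Module k X] [AddCommMonoid M] [Module k M]

variable (M) in
/-- The action on the left factor of `X ⊗ M` that is given by an action on `X`. -/
def onLeft (γ : B →ₐ[k] Module.End k X) : B →ₐ[k] Module.End k (X ⊗[k] M) :=
  (Module.End.rTensorAlgHom k X M).comp γ

variable (X) in
/-- The action on the right factor of `X ⊗ M` that is given by an action on `M`. -/
def onRight (α : B →ₐ[k] Module.End k M) : B →ₐ[k] Module.End k (X ⊗[k] M) :=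
  (Module.End.lTensorAlgHom k M X).comp α

@[simp]
theorem onLeft_tmul (γ : B →ₐ[k] Module.End k X) (b : B) (x : X) (m : M) :
    onLeft M γ b (x ⊗ₜ m) = γ b x ⊗ₜ m := rfl

@[simp]
theorem onRight_tmul (α : B →ₐ[k] Module.End k M) (b : B) (x : X) (m : M) :
    onRight X α b (x ⊗ₜ m) = x ⊗ₜ α b m := rfl

theorem commute_onLeft_onRight {B' : Type*} [Semiring B'] [Algebra k B']
    (γ : B →ₐ[k] Module.End k X) (α : B' →ₐ[k] Module.End k M) (b : B) (b' : B') :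
    Commute (onLeft M γ b) (onRight X α b') := by
  ext x m
  simp

theorem lid_rTensor_onRight (f : Module.Dual k X) (α : B →ₐ[k] Module.End k M) (b : B)
    (u : X ⊗[k] M) :
    TensorProduct.lid k M (f.rTensor M (onRight X α b u)) =
      α b (TensorProduct.lid k M (f.rTensor M u)) := by
  have h : (TensorProduct.lid k M).toLinearMap ∘ₗ f.rTensor M ∘ₗ onRight X α b =
      α b ∘ₗ (TensorProduct.lid k M).toLinearMap ∘ₗ f.rTensor M := by
    ext
    simp
  exact congr($h u)

end TensorFactors

namespace ActionCoaction

section DiagonalAction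

variable {k H M N : Type*} [Field k] [Ring H] [HopfAlgebra k H] [AddCommGroup M] [Module k M]
  [AddCommGroup N] [Module k N]

section Tensor

variable (V : ActionCoaction k H M) (W : ActionCoaction k H N)

theorem tensor_act : (V.tensor W).act.toLinearMap =
    convSMul comul (onLeft N V.act).toLinearMap (onRight M W.act).toLinearMap := by
  ext h : 1
  rw [convSMul_apply_of_eq_sum (ℛ k h).eq.symm]
  ext x y
  simp [tensor, ← (ℛ k h).eq, Module.endTensorEndAlgHom_apply]

theorem convSMul_tensor_coact {A P : Type*} [Semiring A] [Algebra k A] [AddCommMonoid P]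
    [Module k P] [Module A P] [IsScalarTower k A P] {F : H →ₗ[k] A}
    (hF : ∀ g h, F (g * h) = F h * F g) (G : M →ₗ[k] N →ₗ[k] P) (m : M) (n : N) :
    convSMul (V.tensor W).coact F (TensorProduct.lift G) (m ⊗ₜ n) =
      convSMul W.coact F (convSMul V.coact F G m) n := by
  obtain ⟨s, hs⟩ := TensorProduct.exists_finset (V.coact m)
  obtain ⟨t, ht⟩ := TensorProduct.exists_finset (W.coact n)
  have hst : (V.tensor W).coact (m ⊗ₜ n) =
      ∑ p ∈ t ×ˢ s, (p.2.1 * p.1.1) ⊗ₜ (p.2.2 ⊗ₜ p.1.2) := by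
    simp [tensor, hs, ht, TensorProduct.sum_tmul, TensorProduct.tmul_sum, Finset.sum_product]
  rw [convSMul_apply_of_eq_sum hst, convSMul_apply_of_eq_sum ht, convSMul_apply_of_eq_sum hs]
  simp [Finset.sum_product, hF, mul_smul, Finset.smul_sum]

end Tensor

theorem convSMul_convSMul_comul {V : ActionCoaction k H M} [Coalgebra k M]
    (hV : V.IsHom (V.tensor V) (comul (R := k))) {A P : Type*} [Semiring A] [Algebra k A]
    [AddCommMonoid P] [Module k P] [Module A P] [IsScalarTower k A P] {F : H →ₗ[k] A}
    (hF : ∀ g h, F (g * h) = F h * F g) {B : M →ₗ[k] A}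
    (hFB : ∀ h m, Commute (convSMul V.coact F B m) (F h)) (G : M →ₗ[k] P) :
    convSMul V.coact F (convSMul comul B G) =
      convSMul comul (convSMul V.coact F B) (convSMul V.coact F G) := by
  have hB (m n : M) :
      convSMul V.coact F ((Algebra.lsmul k k P).toLinearMap.compl₁₂ B G) m n =
        convSMul V.coact F B m • G n :=
    (map_convSMul (F' := F) (G' := (Algebra.lsmul k k P).toLinearMap.flip (G n) ∘ₗ B)
      (LinearMap.applyₗ n) (fun _ _ => rfl) m).trans
      (map_convSMul ((Algebra.lsmul k k P).toLinearMap.flip (G n))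
        (fun _ _ => by simp) m).symm
  conv_lhs => rw [convSMul.eq_1 comul]
  rw [← convSMul_comp_of_colinear hV.map_coact, convSMul.eq_1 comul]
  congr 1
  ext m n
  simp only [TensorProduct.AlgebraTensorModule.curry_apply, LinearMap.restrictScalars_self,
    TensorProduct.curry_apply, convSMul_tensor_coact V V hF, TensorProduct.lift.tmul,
    LinearMap.compl₁₂_apply, AlgHom.toLinearMap_apply, Algebra.lsmul_coe]
  refine (map_convSMul ((Algebra.lsmul k k P).toLinearMap (convSMul V.coact F B m))
    (fun h n => ?_) n).symm
  simp [hB, ← mul_smul, (hFB h m).eq]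

end DiagonalAction

section BraidedAction

section AntipodeAct

variable {k H M N : Type*} [Field k] [Ring H] [HopfAlgebra k H] [AddCommGroup M] [Module k M]
  [AddCommGroup N] [Module k N]

/-- The right action of `H` through its antipode, as the map `h ↦ (m ↦ S(h) m)`. -/
def antipodeAct (V : ActionCoaction k H M) : H →ₗ[k] Module.End k M :=
  V.act.toLinearMap ∘ₗ HopfAlgebra.antipode k

theorem antipodeAct_mul (V : ActionCoaction k H M) (g h : H) :
    V.antipodeAct (g * h) = V.antipodeAct h * V.antipodeAct g := by
  simp [antipodeAct, HopfAlgebra.antipode_mul_antidistrib]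

theorem onRight_mul_tensor_antipodeAct (V : ActionCoaction k H M) (W : ActionCoaction k H N) :
    toConv (onRight M W.act).toLinearMap * toConv (V.tensor W).antipodeAct =
      toConv ((onLeft N V.act).toLinearMap ∘ₗ HopfAlgebra.antipode k) := by
  have hleft := algHom_comp_mul_algHom (LinearMap.antipode_mul_id (R := k)) (onLeft N V.act)
  have htensor := algHom_mul_algHom_comp (LinearMap.id_mul_antipode (R := k)) (V.tensor W).act
  nth_rewrite 1 [tensor_act] at htensor
  rw [convSMul_comul, toConv_ofConv, mul_assoc] at htensor
  exact (left_inv_eq_right_inv hleft htensor).symm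

end AntipodeAct

variable {k H R M : Type*} [Field k] [Ring H] [HopfAlgebra k H] [AddCommGroup M] [Module k M]

theorem IsYetterDrinfeld.isLeftComodule {V : ActionCoaction k H M} (hV : V.IsYetterDrinfeld) :
    IsLeftComodule V.coact :=
  ⟨hV.coassoc, hV.counit_coact⟩

variable [Ring R] [Algebra k R] {V : ActionCoaction k H R}

variable (V) in
/-- The braided action of `R` on `R ⊗ M` by `y (r ⊗ m) = y₍₋₁₎ r ⊗ y₍₀₎ m`. -/
def braidedAct (α : R →ₐ[k] Module.End k M) : R →ₗ[k] Module.End k (R ⊗[k] M) :=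
  convSMul V.coact (onLeft M V.act).toLinearMap (onRight R α).toLinearMap

theorem braidedAct_apply (α : R →ₐ[k] Module.End k M) (y : R) :
    V.braidedAct α y =
      Module.endTensorEndAlgHom (S := k) (Algebra.TensorProduct.map V.act α (V.coact y)) := by
  obtain ⟨s, hs⟩ := TensorProduct.exists_finset (V.coact y)
  rw [braidedAct, convSMul_apply_of_eq_sum hs, hs]
  ext r m
  simp [Module.endTensorEndAlgHom_apply]

theorem map_mul_midBraiding_tmul (a b : R) (u : R ⊗[k] R) :
    TensorProduct.map (LinearMap.mul' k R) (LinearMap.mul' k R) (V.midBraiding ((a ⊗ₜ b) ⊗ₜ u)) =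
      onLeft R (Algebra.lmul k R) a (V.braidedAct (Algebra.lmul k R) b u) := by
  obtain ⟨s, hs⟩ := TensorProduct.exists_finset (V.coact b)
  have h : TensorProduct.map (LinearMap.mul' k R) (LinearMap.mul' k R) ∘ₗ V.midBraiding ∘ₗ
      TensorProduct.mk k _ _ (a ⊗ₜ b) =
      onLeft R (Algebra.lmul k R) a ∘ₗ V.braidedAct (Algebra.lmul k R) b := by
    rw [braidedAct, convSMul_apply_of_eq_sum hs]
    ext c d
    simp [midBraiding, braiding, actLin, hs, TensorProduct.sum_tmul, TensorProduct.tmul_sum]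
  exact congr($h u)

variable [Coalgebra k R]

variable (V) in
/-- The action `y (r ⊗ m) = y₍₁₎ (y₍₂₎₍₋₁₎ r) ⊗ y₍₂₎₍₀₎ m` of `R` on `R ⊗ M` through the
comultiplication. -/
def comulAct (α : R →ₐ[k] Module.End k M) : R →ₗ[k] Module.End k (R ⊗[k] M) :=
  convSMul comul (onLeft M (Algebra.lmul k R)).toLinearMap (V.braidedAct α)

theorem commute_lTensor_comulAct (α : R →ₐ[k] Module.End k M) {f : Module.End k M}
    (hf : ∀ x, Commute f (α x)) (x : R) : Commute (f.lTensor R) (V.comulAct α x) := by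
  refine commute_convSMul (fun y => ?_) (commute_convSMul (fun h => ?_) fun y => ?_) x
  · ext r m
    simp
  · ext r m
    simp
  · ext r m
    simpa using congr(r ⊗ₜ[k] $(hf y) m)

/-- `S` is an antipode of `R` in the category of Yetter-Drinfeld modules: a morphism that is a
convolution inverse of the identity. -/
structure IsAntipode (V : ActionCoaction k H R) (S : R →ₗ[k] R) : Prop where
  isHom : V.IsHom V S
  mul_id : toConv S * toConv .id = 1
  id_mul : toConv .id * toConv S = 1

variable {S : R →ₗ[k] R}

theorem IsAntipode.shear_bijective (hS : V.IsAntipode S) (α : R →ₐ[k] Module.End k M) :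
    Function.Bijective (shear α.toLinearMap) :=
  _root_.shear_bijective (algHom_comp_mul_algHom hS.mul_id α) (algHom_mul_algHom_comp hS.id_mul α)

theorem IsAntipode.convSMul_onLeft_comulAct (hS : V.IsAntipode S) (α : R →ₐ[k] Module.End k M) :
    convSMul comul ((onLeft M (Algebra.lmul k R)).toLinearMap ∘ₗ S) (V.comulAct α) =
      V.braidedAct α :=
  (isLeftComodule_comul k R).convSMul_convSMul_of_mul_eq_one
    (algHom_comp_mul_algHom hS.mul_id _) _

namespace IsHopfAlgebra

theorem exists_isAntipode (hV : V.IsHopfAlgebra) : ∃ S, V.IsAntipode S := by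
  obtain ⟨S, hS, hl, hr⟩ := hV.exists_antipode
  exact ⟨S, hS, WithConv.ofConv_injective hl, WithConv.ofConv_injective hr⟩

theorem coact_one (hV : V.IsHopfAlgebra) : V.coact 1 = 1 ⊗ₜ 1 := by
  simpa [unit] using congr($(hV.isHom_unit.map_coact) 1)

theorem coact_mul (hV : V.IsHopfAlgebra) (x y : R) : V.coact (x * y) = V.coact x * V.coact y := by
  have h := congr($(hV.isHom_mul.map_coact) (x ⊗ₜ y))
  obtain ⟨s, hs⟩ := TensorProduct.exists_finset (V.coact x)
  obtain ⟨t, ht⟩ := TensorProduct.exists_finset (V.coact y)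
  simp only [LinearMap.comp_apply, LinearMap.mul'_apply] at h
  simp [h, tensor, hs, ht, TensorProduct.sum_tmul, TensorProduct.tmul_sum, Finset.sum_mul_sum,
    Finset.sum_comm (s := t)]

theorem act_one (hV : V.IsHopfAlgebra) (h : H) : V.act h 1 = counit (R := k) h • 1 := by
  simpa [unit, Algebra.algebraMap_eq_smul_one] using congr($(hV.isHom_unit.map_act h) 1).symm

/-- The braided action as a morphism of algebras. -/
def braidedAlgHom (hV : V.IsHopfAlgebra) (α : R →ₐ[k] Module.End k M) :
    R →ₐ[k] Module.End k (R ⊗[k] M) :=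
  AlgHom.ofLinearMap (V.braidedAct α)
    (by simp [braidedAct_apply, hV.coact_one, ← Algebra.TensorProduct.one_def])
    fun x y => by simp [braidedAct_apply, hV.coact_mul]

theorem comul_mul_apply (hV : V.IsHopfAlgebra) (x y : R) :
    comul (R := k) (x * y) = V.comulAct (Algebra.lmul k R) x (comul (R := k) y) := by
  have h := congr($(hV.comul_mul) (x ⊗ₜ y))
  simp only [LinearMap.comp_apply, LinearMap.mul'_apply, TensorProduct.map_tmul] at h
  rw [h, comulAct, convSMul_apply_of_eq_sum (ℛ k x).eq.symm]
  conv_lhs => rw [← (ℛ k x).eq]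
  simp [TensorProduct.sum_tmul, map_mul_midBraiding_tmul]

end IsHopfAlgebra

end BraidedAction

end ActionCoaction

section AntipodeMul

variable {k R : Type*} [CommSemiring k] [Semiring R] [Algebra k R]

/-- The map `a ⊗ b ↦ S(a) b`. -/
def antipodeMul (S : R →ₗ[k] R) : R ⊗[k] R →ₗ[k] R := LinearMap.mul' k R ∘ₗ S.rTensor R

@[simp]
theorem antipodeMul_tmul (S : R →ₗ[k] R) (a b : R) : antipodeMul S (a ⊗ₜ[k] b) = S a * b := by
  simp [antipodeMul]

theorem antipodeMul_lTensor_mulRight (S : R →ₗ[k] R) (b : R) (u : R ⊗[k] R) :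
    antipodeMul S ((LinearMap.mulRight k b).lTensor R u) = antipodeMul S u * b := by
  have h : antipodeMul S ∘ₗ (LinearMap.mulRight k b).lTensor R =
      LinearMap.mulRight k b ∘ₗ antipodeMul S := by
    ext
    simp [mul_assoc]
  exact congr($h u)

end AntipodeMul

namespace ActionCoaction

section DualAct

variable {k H R : Type*} [Field k] [Ring H] [HopfAlgebra k H] [Ring R] [Algebra k R]
  {V : ActionCoaction k H R}

variable (V) in
/-- The map `h ↦ (x ↦ (h z) x)`. -/
def actMul (z : R) : H →ₗ[k] Module.End k R :=
  (Algebra.lmul k R).toLinearMap ∘ₗ V.act.toLinearMap.flip z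

variable (V) in
/-- The map `y ↦ (x ↦ S(y₍₋₁₎) (S(y₍₀₎) x))`, in which the first `S` is the antipode of `H`. This is
the action of the antipode of the bosonization of `R` by `H`, so it turns products around. -/
def dualAct (S : R →ₗ[k] R) : R →ₗ[k] Module.End k R :=
  convSMul V.coact V.antipodeAct ((Algebra.lmul k R).toLinearMap ∘ₗ S)

variable [Coalgebra k R] {S : R →ₗ[k] R}

namespace IsAntipode

theorem antipodeMul_comul (hS : V.IsAntipode S) (x : R) :
    antipodeMul S (comul x) = counit (R := k) x • 1 := by
  rw [← Algebra.algebraMap_eq_smul_one]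
  exact congr($hS.mul_id x)

theorem map_act (hS : V.IsAntipode S) (h : H) (x : R) : S (V.act h x) = V.act h (S x) :=
  congr($(hS.isHom.map_act h) x)

end IsAntipode

namespace IsHopfAlgebra

theorem antipodeMul_comulAct (hV : V.IsHopfAlgebra) (hS : V.IsAntipode S) (x : R)
    (u : R ⊗[k] R) :
    antipodeMul S (V.comulAct (Algebra.lmul k R) x u) =
      counit (R := k) x • antipodeMul S u := by
  have h : antipodeMul S ∘ₗ V.comulAct (Algebra.lmul k R) x ∘ₗ
      shear (Algebra.lmul k R).toLinearMap =
      counit (R := k) x • antipodeMul S ∘ₗ shear (Algebra.lmul k R).toLinearMap := by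
    ext z w
    have hcomm : Commute ((LinearMap.mulRight k w).lTensor R) (V.comulAct (Algebra.lmul k R) x) :=
      commute_lTensor_comulAct _ (fun z => by ext; simp [mul_assoc]) x
    have hz : shear (Algebra.lmul k R).toLinearMap (z ⊗ₜ w) =
        (LinearMap.mulRight k w).lTensor R (comul z) := shear_tmul _ _ _
    have hx : V.comulAct (Algebra.lmul k R) x ((LinearMap.mulRight k w).lTensor R (comul z)) =
        (LinearMap.mulRight k w).lTensor R (comul (x * z)) := by
      rw [hV.comul_mul_apply]
      exact congr($hcomm.eq.symm (comul z))
    simp [hz, hx, antipodeMul_lTensor_mulRight, hS.antipodeMul_comul, hV.counit_mul, mul_smul]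
  obtain ⟨v, rfl⟩ := (hS.shear_bijective (Algebra.lmul k R)).surjective u
  exact congr($h v)

theorem convSMul_comulAct_braidedAct_antipode (hV : V.IsHopfAlgebra) (hS : V.IsAntipode S) :
    convSMul comul (V.comulAct (Algebra.lmul k R)) (V.braidedAct (Algebra.lmul k R) ∘ₗ S) =
      (onLeft R (Algebra.lmul k R)).toLinearMap := by
  have hB : toConv (V.braidedAct (Algebra.lmul k R)) *
      toConv (V.braidedAct (Algebra.lmul k R) ∘ₗ S) = 1 :=
    algHom_mul_algHom_comp hS.id_mul (hV.braidedAlgHom (Algebra.lmul k R))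
  rw [convSMul_comul, comulAct, convSMul_comul, toConv_ofConv, mul_assoc, hB, mul_one]

theorem antipodeMul_onLeft (hV : V.IsHopfAlgebra) (hS : V.IsAntipode S) (x : R) (u : R ⊗[k] R) :
    antipodeMul S (onLeft R (Algebra.lmul k R) x u) =
      antipodeMul S (V.braidedAct (Algebra.lmul k R) (S x) u) := by
  let G : R →ₗ[k] R :=
    antipodeMul S ∘ₗ LinearMap.applyₗ u ∘ₗ V.braidedAct (Algebra.lmul k R) ∘ₗ S
  have h := map_convSMul (δ := comul) (F := V.comulAct (Algebra.lmul k R))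
    (G := V.braidedAct (Algebra.lmul k R) ∘ₗ S) (F' := counit) (G' := G)
    (antipodeMul S ∘ₗ LinearMap.applyₗ u)
    (fun a b => by simp [G, hV.antipodeMul_comulAct hS]) x
  rwa [hV.convSMul_comulAct_braidedAct_antipode hS,
    (isLeftComodule_comul k R).counit_convSMul] at h

theorem lmul_antipode_mul (hV : V.IsHopfAlgebra) (hS : V.IsAntipode S) (y z : R) :
    Algebra.lmul k R (S (y * z)) =
      convSMul V.coact (V.actMul (S z)) ((Algebra.lmul k R).toLinearMap ∘ₗ S) y := by
  have hS' : V.braidedAct (Algebra.lmul k R) (S y) = convSMul V.coact (onLeft R V.act).toLinearMap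
      ((onRight R (Algebra.lmul k R)).toLinearMap ∘ₗ S) y :=
    congr($(convSMul_comp_of_colinear hS.isHom.map_coact _ _) y)
  ext x
  have h := hV.antipodeMul_onLeft hS y (z ⊗ₜ x)
  rw [hS', onLeft_tmul, antipodeMul_tmul] at h
  refine h.trans ?_
  rw [convSMul_apply_apply, convSMul_apply_apply]
  refine map_convSMul (antipodeMul S) (fun a b => ?_) y
  simp [actMul, hS.map_act]

theorem act_mul_lmul (hV : V.IsHopfAlgebra) (h : H) (z : R) :
    V.act h * Algebra.lmul k R z = convSMul comul (V.actMul z) V.act.toLinearMap h := by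
  ext x
  have hact := congr($(hV.isHom_mul.map_act h) (z ⊗ₜ x))
  have htensor := congr($(V.tensor_act V) h)
  rw [AlgHom.toLinearMap_apply] at htensor
  rw [LinearMap.comp_apply, htensor] at hact
  simpa [convSMul_apply_of_eq_sum (ℛ k h).eq.symm, actMul] using hact.symm

theorem convSMul_antipodeAct_actMul (hV : V.IsHopfAlgebra) (z : R) :
    convSMul comul V.antipodeAct (V.actMul z) =
      LinearMap.mulLeft k (Algebra.lmul k R z) ∘ₗ V.antipodeAct := by
  have hl : toConv V.antipodeAct * toConv V.act.toLinearMap = 1 :=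
    algHom_comp_mul_algHom LinearMap.antipode_mul_id V.act
  have hr : toConv V.act.toLinearMap * toConv V.antipodeAct = 1 :=
    algHom_mul_algHom_comp LinearMap.id_mul_antipode V.act
  have hmul : toConv (V.actMul z) * toConv V.act.toLinearMap =
      toConv (LinearMap.mulRight k (Algebra.lmul k R z) ∘ₗ V.act.toLinearMap) := by
    refine WithConv.ofConv_injective ?_
    rw [← convSMul_comul]
    ext h : 1
    exact (hV.act_mul_lmul h z).symm
  have hz : V.actMul z = convSMul comul V.act.toLinearMap
      (LinearMap.mulLeft k (Algebra.lmul k R z) ∘ₗ V.antipodeAct) := by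
    calc V.actMul z
      _ = (toConv (V.actMul z) * toConv V.act.toLinearMap * toConv V.antipodeAct).ofConv := by
        rw [mul_assoc, hr, mul_one]
      _ = convSMul comul V.act.toLinearMap
          (LinearMap.mulLeft k (Algebra.lmul k R z) ∘ₗ V.antipodeAct) := by
        rw [hmul, ← convSMul_comul]
        ext h : 1
        simp [convSMul_apply_of_eq_sum (ℛ k h).eq.symm, mul_assoc]
  rw [hz, (isLeftComodule_comul k H).convSMul_convSMul_of_mul_eq_one hl]

theorem convSMul_antipodeAct_lmul_antipode_mul (hV : V.IsHopfAlgebra) (hS : V.IsAntipode S)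
    (y z : R) :
    convSMul V.coact V.antipodeAct
        ((Algebra.lmul k R).toLinearMap ∘ₗ S ∘ₗ LinearMap.mulRight k z) y =
      Algebra.lmul k R (S z) * V.dualAct S y := by
  have h : (Algebra.lmul k R).toLinearMap ∘ₗ S ∘ₗ LinearMap.mulRight k z =
      convSMul V.coact (V.actMul (S z)) ((Algebra.lmul k R).toLinearMap ∘ₗ S) := by
    ext y : 1
    exact hV.lmul_antipode_mul hS y z
  rw [h, hV.isYetterDrinfeld.isLeftComodule.convSMul_convSMul, ← convSMul_comul,
    hV.convSMul_antipodeAct_actMul]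
  exact (map_convSMul (LinearMap.mulLeft k (Algebra.lmul k R (S z)))
    (fun a b => by simp [mul_assoc]) y).symm

theorem dualAct_mul (hV : V.IsHopfAlgebra) (hS : V.IsAntipode S) (y z : R) :
    V.dualAct S (y * z) = V.dualAct S z * V.dualAct S y := by
  let G : R →ₗ[k] R →ₗ[k] Module.End k R :=
    (LinearMap.mul k R).compr₂ ((Algebra.lmul k R).toLinearMap ∘ₗ S)
  have hG : TensorProduct.lift G = ((Algebra.lmul k R).toLinearMap ∘ₗ S) ∘ₗ LinearMap.mul' k R := by
    ext
    simp [G]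
  have hy : convSMul V.coact V.antipodeAct G y =
      LinearMap.mulRight k (V.dualAct S y) ∘ₗ (Algebra.lmul k R).toLinearMap ∘ₗ S := by
    ext z : 1
    exact (map_convSMul (LinearMap.applyₗ z) (fun _ _ => rfl) y).trans
      (hV.convSMul_antipodeAct_lmul_antipode_mul hS y z)
  have h := convSMul_tensor_coact V V V.antipodeAct_mul G y z
  rw [hG, ← convSMul_comp_of_colinear hV.isHom_mul.map_coact, hy] at h
  refine h.trans ?_
  exact (map_convSMul (LinearMap.mulRight k (V.dualAct S y))
    (fun a b => by simp [mul_assoc]) z).symm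

theorem dualAct_one (hV : V.IsHopfAlgebra) (hS : V.IsAntipode S) : V.dualAct S 1 = 1 := by
  have hone : S 1 = 1 := by
    simpa [hV.comul_one, hV.counit_one] using hS.antipodeMul_comul 1
  ext x
  simp [dualAct, convSMul, hV.coact_one, hone, antipodeAct]

end IsHopfAlgebra

end DualAct

section HopfModule

variable {k H R M : Type*} [Field k] [Ring H] [HopfAlgebra k H] [Ring R] [Algebra k R]
  [Coalgebra k R] [AddCommGroup M] [Module k M] {V : ActionCoaction k H R} {S : R →ₗ[k] R}
  {α : R →ₐ[k] Module.End k M} {ρ : M →ₗ[k] R ⊗[k] M}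

variable (V α ρ) in
/-- `M`, with the action `α` and the coaction `ρ` of `R`, is a Hopf module over `R`. Here `R ⊗ M`
carries the braided diagonal action in which `M` is regarded as a module over `R` only. -/
structure IsHopfModule : Prop where
  isLeftComodule : IsLeftComodule ρ
  coact_act : ∀ y m, ρ (α y m) = V.comulAct α y (ρ m)

namespace IsHopfAlgebra

theorem braidedAct_one_tmul (hV : V.IsHopfAlgebra) (α : R →ₐ[k] Module.End k M) (y : R) (m : M) :
    V.braidedAct α y (1 ⊗ₜ m) = 1 ⊗ₜ α y m := by
  have h := map_convSMul (δ := V.coact) (F := (onLeft M V.act).toLinearMap)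
    (G := (onRight R α).toLinearMap) (F' := counit)
    (G' := TensorProduct.mk k R M 1 ∘ₗ α.toLinearMap.flip m) (LinearMap.applyₗ (1 ⊗ₜ m))
    (fun h r => by simp [hV.act_one, TensorProduct.smul_tmul]) y
  rwa [hV.isYetterDrinfeld.isLeftComodule.counit_convSMul] at h

theorem comulAct_one_tmul (hV : V.IsHopfAlgebra) (α : R →ₐ[k] Module.End k M) (y : R) (m : M) :
    V.comulAct α y (1 ⊗ₜ m) = shear α.toLinearMap (y ⊗ₜ m) := by
  rw [comulAct, convSMul_apply_of_eq_sum (ℛ k y).eq.symm, shear_tmul]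
  conv_rhs => rw [← (ℛ k y).eq]
  simp [hV.braidedAct_one_tmul]

theorem shear_comulAct_tmul_one_tmul (hV : V.IsHopfAlgebra) (α : R →ₐ[k] Module.End k M) (y : R)
    (m : M) :
    shear (V.comulAct α) (y ⊗ₜ (1 ⊗ₜ m)) =
      TensorProduct.assoc k R R M (comul.rTensor M (shear α.toLinearMap (y ⊗ₜ m))) := by
  have hone : (V.comulAct α).flip (1 ⊗ₜ m) = (α.toLinearMap.flip m).lTensor R ∘ₗ comul := by
    ext y
    simp [hV.comulAct_one_tmul, shear_tmul]
  have hassoc : TensorProduct.assoc k R R M ∘ₗ comul.rTensor M ∘ₗ (α.toLinearMap.flip m).lTensor R =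
      ((α.toLinearMap.flip m).lTensor R).lTensor R ∘ₗ TensorProduct.assoc k R R R ∘ₗ
        comul.rTensor R := by
    ext a b
    simp [← (ℛ k a).eq, TensorProduct.sum_tmul]
  rw [shear_tmul, shear_tmul, hone, LinearMap.lTensor_comp, LinearMap.comp_apply, ← coassoc_apply]
  exact congr($hassoc (comul y)).symm

theorem shear_comulAct_injective (hV : V.IsHopfAlgebra) (hS : V.IsAntipode S)
    (α : R →ₐ[k] Module.End k M) : Function.Injective (shear (V.comulAct α)) := by
  rw [comulAct, convSMul_comul, shear_mul]
  exact (hS.shear_bijective _).injective.comp (hS.shear_bijective (hV.braidedAlgHom α)).injective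

end IsHopfAlgebra

namespace IsHopfModule

theorem eq_zero_of_apply_coinvariant (hM : V.IsHopfModule α ρ) (hV : V.IsHopfAlgebra)
    (hS : V.IsAntipode S) {m : M} (hm : ρ m = 1 ⊗ₜ m) (hm0 : m ≠ 0) {y : R} (hy : α y m = 0) :
    y = 0 := by
  have hshear : shear α.toLinearMap (y ⊗ₜ m) = 0 := by
    rw [← hV.comulAct_one_tmul, ← hm, ← hM.coact_act, hy, map_zero]
  have htmul : y ⊗ₜ[k] m = 0 := (hS.shear_bijective α).injective (by rw [hshear, map_zero])
  have hsmul (f : Module.Dual k M) : f m • y = 0 := by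
    simpa using congr(TensorProduct.rid k R (f.lTensor R $htmul))
  obtain ⟨f, hf⟩ := Module.Projective.exists_dual_ne_zero k hm0
  exact (smul_eq_zero.1 (hsmul f)).resolve_left hf

/-- If `ρ m = shear α w` with `m ≠ 0`, then `R ⊗ ρ` and `R ⊗ (1 ⊗ ·)` agree on `w ≠ 0`, so that the
difference of `ρ` and `1 ⊗ ·` is not injective. -/
theorem exists_coinvariant_ne_zero (hM : V.IsHopfModule α ρ) (hV : V.IsHopfAlgebra)
    (hS : V.IsAntipode S) [Nontrivial M] : ∃ m, m ≠ 0 ∧ ρ m = 1 ⊗ₜ m := by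
  obtain ⟨m, hm⟩ := exists_ne (0 : M)
  obtain ⟨w, hw⟩ := (hS.shear_bijective α).surjective (ρ m)
  have hshear : shear (V.comulAct α) ∘ₗ (TensorProduct.mk k R M 1).lTensor R =
      TensorProduct.assoc k R R M ∘ₗ comul.rTensor M ∘ₗ shear α.toLinearMap := by
    ext y m
    exact hV.shear_comulAct_tmul_one_tmul α y m
  have heq : ρ.lTensor R w = (TensorProduct.mk k R M 1).lTensor R w := by
    refine hV.shear_comulAct_injective hS α ?_
    calc shear (V.comulAct α) (ρ.lTensor R w)
      _ = ρ.lTensor R (ρ m) := by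
        rw [← hw]
        exact congr($(lTensor_comp_shear (β := α.toLinearMap) hM.coact_act) w).symm
      _ = TensorProduct.assoc k R R M (comul.rTensor M (ρ m)) :=
        congr($hM.isLeftComodule.coassoc m).symm
      _ = _ := by
        rw [← hw]
        exact congr($hshear w).symm
  by_contra! hne
  have hinj : Function.Injective (ρ - TensorProduct.mk k R M 1) := by
    refine (injective_iff_map_eq_zero _).2 fun m h => ?_
    by_contra hm0
    exact hne m hm0 (sub_eq_zero.1 h)
  have hw0 : w = 0 := by
    refine Module.Flat.lTensor_preserves_injective_linearMap (M := R) _ hinj ?_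
    rw [LinearMap.lTensor_sub, LinearMap.sub_apply, heq, sub_self, map_zero]
  refine hm (hM.isLeftComodule.injective ?_)
  rw [← hw, hw0, map_zero, map_zero]

end IsHopfModule

end HopfModule

section ComulDualAct

variable {k H R : Type*} [Field k] [Ring H] [HopfAlgebra k H] [Ring R] [Algebra k R]
  [Coalgebra k R] {V : ActionCoaction k H R} {S : R →ₗ[k] R}

namespace IsHopfAlgebra

theorem convSMul_braidedAct_comul_antipode (hV : V.IsHopfAlgebra) (hS : V.IsAntipode S) (x y : R) :
    convSMul comul (V.braidedAct (Algebra.lmul k R)) (comul ∘ₗ LinearMap.mulRight k x ∘ₗ S) y =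
      onLeft R (Algebra.lmul k R) (S y) (comul (R := k) x) := by
  have hcomul : convSMul comul (V.comulAct (Algebra.lmul k R))
      (comul ∘ₗ LinearMap.mulRight k x ∘ₗ S) = (counit (R := k)).smulRight (comul x) := by
    ext z : 1
    have hz : convSMul comul (LinearMap.id (R := k)) S z = counit (R := k) z • 1 := by
      rw [convSMul_comul, ← Algebra.algebraMap_eq_smul_one]
      exact congr($hS.id_mul z)
    have h := map_convSMul (δ := comul) (F := LinearMap.id (R := k) (M := R)) (G := S)
      (F' := V.comulAct (Algebra.lmul k R)) (G' := comul ∘ₗ LinearMap.mulRight k x ∘ₗ S)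
      (comul ∘ₗ LinearMap.mulRight k x)
      (fun a b => by simp [mul_assoc, hV.comul_mul_apply a]) z
    rw [hz] at h
    simpa using h.symm
  rw [← hS.convSMul_onLeft_comulAct, convSMul_comul, ← toConv_ofConv (toConv _ * _),
    ← (isLeftComodule_comul k R).convSMul_convSMul, hcomul, convSMul_comul_counit]
  rfl

theorem convSMul_antipode_braidedAct (hV : V.IsHopfAlgebra) :
    convSMul V.coact ((onLeft R V.act).toLinearMap ∘ₗ HopfAlgebra.antipode k)
      (V.braidedAct (Algebra.lmul k R)) = (onRight R (Algebra.lmul k R)).toLinearMap :=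
  hV.isYetterDrinfeld.isLeftComodule.convSMul_convSMul_of_mul_eq_one
    (algHom_comp_mul_algHom LinearMap.antipode_mul_id _) _

theorem comul_dualAct (hV : V.IsHopfAlgebra) (x : R) :
    comul ∘ₗ (V.dualAct S).flip x =
      convSMul V.coact (V.tensor V).antipodeAct (comul ∘ₗ LinearMap.mulRight k x ∘ₗ S) := by
  ext y : 1
  refine map_convSMul (comul ∘ₗ LinearMap.applyₗ x) (fun h z => ?_) y
  simpa [antipodeAct] using
    congr($(hV.isHom_comul.map_act (HopfAlgebra.antipode k h)) (S z * x))

theorem rTensor_dualAct_comul (hV : V.IsHopfAlgebra) (hS : V.IsAntipode S) (x y : R) :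
    (V.dualAct S y).rTensor R (comul x) =
      convSMul comul (onRight R (Algebra.lmul k R)).toLinearMap
        (convSMul V.coact (onRight R V.act).toLinearMap (comul ∘ₗ (V.dualAct S).flip x)) y := by
  let F : H →ₗ[k] Module.End k (R ⊗[k] R) :=
    (onLeft R V.act).toLinearMap ∘ₗ HopfAlgebra.antipode k
  have hF (g h : H) : F (g * h) = F h * F g := by
    simp [F, HopfAlgebra.antipode_mul_antidistrib]
  have hFB : convSMul V.coact F (V.braidedAct (Algebra.lmul k R)) =
      (onRight R (Algebra.lmul k R)).toLinearMap := hV.convSMul_antipode_braidedAct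
  have hcomm (h : H) (m : R) :
      Commute (convSMul V.coact F (V.braidedAct (Algebra.lmul k R)) m) (F h) := by
    rw [hFB]
    exact (commute_onLeft_onRight _ _ _ _).symm
  rw [hV.comul_dualAct, hV.isYetterDrinfeld.isLeftComodule.convSMul_convSMul,
    onRight_mul_tensor_antipodeAct, ofConv_toConv, ← hFB,
    ← convSMul_convSMul_comul hV.isHom_comul hF hcomm]
  refine map_convSMul (LinearMap.applyₗ (comul x) ∘ₗ LinearMap.rTensorHom R) (fun h z => ?_) y
  rw [hV.convSMul_braidedAct_comul_antipode hS]
  exact congr($((LinearMap.rTensor_mul R (V.antipodeAct h) (Algebra.lmul k R (S z)))) (comul x))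

end IsHopfAlgebra

end ComulDualAct

end ActionCoaction

section DualComodule

variable (k C W : Type*) [CommSemiring k] [AddCommMonoid C] [Module k C] [AddCommMonoid W]
  [Module k W]

/-- The identification of `W ⊗ C*` with the maps `C → W`, for finite projective `C`. -/
def tensorDualEquivHom [Module.Projective k C] [Module.Finite k C] :
    W ⊗[k] Module.Dual k C ≃ₗ[k] (C →ₗ[k] W) :=
  TensorProduct.comm k W (Module.Dual k C) ≪≫ₗ dualTensorHomEquiv k C W

variable {k C W}

section Equiv

variable [Module.Projective k C] [Module.Finite k C]

@[simp]
theorem tensorDualEquivHom_tmul_apply (w : W) (f : Module.Dual k C) (x : C) :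
    tensorDualEquivHom k C W (w ⊗ₜ f) x = f x • w := by
  simp [tensorDualEquivHom]

theorem tensorDualEquivHom_rTensor {W' : Type*} [AddCommMonoid W'] [Module k W'] (g : W →ₗ[k] W')
    (u : W ⊗[k] Module.Dual k C) :
    tensorDualEquivHom k C W' (g.rTensor (Module.Dual k C) u) =
      g ∘ₗ tensorDualEquivHom k C W u := by
  have h : (tensorDualEquivHom k C W').toLinearMap ∘ₗ g.rTensor (Module.Dual k C) =
      g.compRight k ∘ₗ (tensorDualEquivHom k C W).toLinearMap := by
    ext
    simp
  exact congr($h u)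

theorem tensorDualEquivHom_assoc_symm_apply {W' : Type*} [AddCommMonoid W'] [Module k W']
    (u : W ⊗[k] (W' ⊗[k] Module.Dual k C)) (x : C) :
    tensorDualEquivHom k C (W ⊗[k] W') ((TensorProduct.assoc k W W' (Module.Dual k C)).symm u) x =
      ((tensorDualEquivHom k C W').toLinearMap.flip x).lTensor W u := by
  have h : (tensorDualEquivHom k C (W ⊗[k] W')).toLinearMap.flip x ∘ₗ
      (TensorProduct.assoc k W W' (Module.Dual k C)).symm.toLinearMap =
      ((tensorDualEquivHom k C W').toLinearMap.flip x).lTensor W := by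
    ext
    simp
  exact congr($h u)

end Equiv

variable [Coalgebra k C]

variable (k C) in
/-- The map `f ↦ (x ↦ f(x₍₁₎) x₍₂₎)`. -/
def leftContract : Module.Dual k C →ₗ[k] Module.End k C where
  toFun f := (TensorProduct.lid k C).toLinearMap ∘ₗ f.rTensor C ∘ₗ comul
  map_add' f g := by simp [LinearMap.rTensor_add, LinearMap.comp_add, LinearMap.add_comp]
  map_smul' c f := by simp [LinearMap.rTensor_smul, LinearMap.comp_smul, LinearMap.smul_comp]

theorem leftContract_apply (f : Module.Dual k C) (x : C) :
    leftContract k C f x = TensorProduct.lid k C (f.rTensor C (comul x)) := rfl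

theorem counit_leftContract (f : Module.Dual k C) (x : C) :
    counit (R := k) (leftContract k C f x) = f x := by
  have h : counit (R := k) ∘ₗ (TensorProduct.lid k C).toLinearMap ∘ₗ f.rTensor C =
      f ∘ₗ TensorProduct.rid k C ∘ₗ (counit (R := k)).lTensor C := by
    ext
    simp [mul_comm]
  simpa [leftContract_apply] using congr($h (comul x))

theorem rTensor_leftContract_comul (f : Module.Dual k C) (x : C) :
    (leftContract k C f).rTensor C (comul x) = comul (leftContract k C f x) := by
  let Θ : C ⊗[k] (C ⊗[k] C) →ₗ[k] C ⊗[k] C :=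
    TensorProduct.lid k (C ⊗[k] C) ∘ₗ f.rTensor (C ⊗[k] C)
  have hl : (leftContract k C f).rTensor C =
      Θ ∘ₗ TensorProduct.assoc k C C C ∘ₗ comul.rTensor C := by
    ext a b
    simp [Θ, leftContract_apply, ← (ℛ k a).eq, TensorProduct.sum_tmul, TensorProduct.smul_tmul']
  have hr : comul ∘ₗ (TensorProduct.lid k C).toLinearMap ∘ₗ f.rTensor C = Θ ∘ₗ comul.lTensor C := by
    ext
    simp [Θ]
  have hΘ : Θ _ = Θ _ := congr(Θ $(coassoc_apply (R := k) x))
  rw [hl]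
  exact hΘ.trans congr($hr (comul x)).symm

variable [Module.Projective k C] [Module.Finite k C]

variable (k C) in
/-- The coaction of a coalgebra on its dual space that corresponds to `leftContract`. -/
def dualCoact : Module.Dual k C →ₗ[k] C ⊗[k] Module.Dual k C :=
  (tensorDualEquivHom k C C).symm ∘ₗ leftContract k C

@[simp]
theorem tensorDualEquivHom_dualCoact (f : Module.Dual k C) :
    tensorDualEquivHom k C C (dualCoact k C f) = leftContract k C f := by
  simp [dualCoact]

theorem lTensor_flip_leftContract (u : C ⊗[k] Module.Dual k C) (x : C) :
    ((leftContract k C).flip x).lTensor C u =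
      (tensorDualEquivHom k C C u).rTensor C (comul x) := by
  have h : ((leftContract k C).flip x).lTensor C = LinearMap.applyₗ (comul x) ∘ₗ
      LinearMap.rTensorHom C ∘ₗ (tensorDualEquivHom k C C).toLinearMap := by
    ext a f
    simp [leftContract_apply, ← (ℛ k x).eq, TensorProduct.tmul_sum, TensorProduct.smul_tmul]
  exact congr($h u)

variable (k C) in
theorem isLeftComodule_dualCoact : IsLeftComodule (dualCoact k C) where
  coassoc := by
    ext f : 1
    apply (TensorProduct.assoc k C C (Module.Dual k C)).symm.injective
    apply (tensorDualEquivHom k C (C ⊗[k] C)).injective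
    ext x : 1
    have hflip : (tensorDualEquivHom k C C).toLinearMap.flip x ∘ₗ dualCoact k C =
        (leftContract k C).flip x := by
      ext
      simp
    calc tensorDualEquivHom k C (C ⊗[k] C) ((TensorProduct.assoc k C C _).symm
          (TensorProduct.assoc k C C _ (comul.rTensor _ (dualCoact k C f)))) x
      _ = comul (leftContract k C f x) := by
        simp [tensorDualEquivHom_rTensor]
      _ = ((leftContract k C).flip x).lTensor C (dualCoact k C f) := by
        rw [lTensor_flip_leftContract, tensorDualEquivHom_dualCoact, rTensor_leftContract_comul]
      _ = tensorDualEquivHom k C (C ⊗[k] C) ((TensorProduct.assoc k C C _).symm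
          ((dualCoact k C).lTensor C (dualCoact k C f))) x := by
        rw [tensorDualEquivHom_assoc_symm_apply, ← hflip, LinearMap.lTensor_comp_apply]
  counit_coact := by
    ext f : 1
    apply (tensorDualEquivHom k C k).injective
    ext x
    simp [tensorDualEquivHom_rTensor, counit_leftContract]

end DualComodule

namespace ActionCoaction

variable {k H R : Type*} [Field k] [Ring H] [HopfAlgebra k H] [Ring R] [Algebra k R]
  [Coalgebra k R] {V : ActionCoaction k H R} {S : R →ₗ[k] R}

/-- The contragredient of `dualAct`: the action of `R` on its dual space. -/
def IsHopfAlgebra.dualAlgHom (hV : V.IsHopfAlgebra) (hS : V.IsAntipode S) :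
    R →ₐ[k] Module.End k (Module.Dual k R) :=
  AlgHom.ofLinearMap (Module.Dual.transpose (R := k) ∘ₗ V.dualAct S)
    (by ext; simp [hV.dualAct_one hS, Module.Dual.transpose_apply])
    fun y z => by ext; simp [hV.dualAct_mul hS, Module.Dual.transpose_apply]

/-- `f` is an integral on the coalgebra `R`: `f(x₍₁₎) x₍₂₎ = f(x) 1`. -/
def IsIntegral (f : Module.Dual k R) : Prop :=
  ∀ x, leftContract k R f x = f x • 1

namespace IsHopfAlgebra

theorem leftContract_dualAlgHom (hV : V.IsHopfAlgebra) (hS : V.IsAntipode S) (y : R)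
    (f : Module.Dual k R) (x : R) :
    leftContract k R (hV.dualAlgHom hS y f) x =
      convSMul comul (Algebra.lmul k R).toLinearMap
        (convSMul V.coact V.act.toLinearMap (leftContract k R f ∘ₗ (V.dualAct S).flip x)) y := by
  let F : R ⊗[k] R →ₗ[k] R := (TensorProduct.lid k R).toLinearMap ∘ₗ f.rTensor R
  have hact (z : R) : F (convSMul V.coact (onRight R V.act).toLinearMap
        (comul ∘ₗ (V.dualAct S).flip x) z) =
      convSMul V.coact V.act.toLinearMap (leftContract k R f ∘ₗ (V.dualAct S).flip x) z :=
    map_convSMul F (fun h z => lid_rTensor_onRight f V.act h (comul (V.dualAct S z x))) z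
  have hdual : leftContract k R (hV.dualAlgHom hS y f) x =
      F ((V.dualAct S y).rTensor R (comul x)) := by
    rw [leftContract_apply]
    exact congr(TensorProduct.lid k R $(LinearMap.rTensor_comp_apply R f (V.dualAct S y) _))
  rw [hdual, hV.rTensor_dualAct_comul hS]
  exact map_convSMul F (fun a z => (lid_rTensor_onRight f (Algebra.lmul k R) a _).trans
    congr(a * $(hact z))) y

variable [FiniteDimensional k R]

theorem tensorDualEquivHom_onRight_dualAlgHom (hV : V.IsHopfAlgebra) (hS : V.IsAntipode S)
    (z : R) (u : R ⊗[k] Module.Dual k R) (x : R) :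
    tensorDualEquivHom k R R (onRight R (hV.dualAlgHom hS) z u) x =
      tensorDualEquivHom k R R u (V.dualAct S z x) := by
  have h : (tensorDualEquivHom k R R).toLinearMap.flip x ∘ₗ onRight R (hV.dualAlgHom hS) z =
      (tensorDualEquivHom k R R).toLinearMap.flip (V.dualAct S z x) := by
    ext
    simp [dualAlgHom, Module.Dual.transpose_apply]
  exact congr($h u)

theorem tensorDualEquivHom_comulAct_dualAlgHom (hV : V.IsHopfAlgebra) (hS : V.IsAntipode S)
    (y : R) (u : R ⊗[k] Module.Dual k R) (x : R) :
    tensorDualEquivHom k R R (V.comulAct (hV.dualAlgHom hS) y u) x =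
      convSMul comul (Algebra.lmul k R).toLinearMap (convSMul V.coact V.act.toLinearMap
        (tensorDualEquivHom k R R u ∘ₗ (V.dualAct S).flip x)) y := by
  let E : Module.End k (R ⊗[k] Module.Dual k R) →ₗ[k] R :=
    (tensorDualEquivHom k R R).toLinearMap.flip x ∘ₗ LinearMap.applyₗ u
  have hleft (g : R →ₗ[k] R) (T : Module.End k (R ⊗[k] Module.Dual k R)) :
      E (g.rTensor (Module.Dual k R) * T) = g (E T) :=
    congr($(tensorDualEquivHom_rTensor g (T u)) x)
  have hact (z : R) : E (V.braidedAct (hV.dualAlgHom hS) z) =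
      convSMul V.coact V.act.toLinearMap
        (tensorDualEquivHom k R R u ∘ₗ (V.dualAct S).flip x) z :=
    map_convSMul E (fun h z => by
      rw [AlgHom.toLinearMap_apply, smul_eq_mul]
      exact (hleft (V.act h) _).trans
        congr(V.act h $(hV.tensorDualEquivHom_onRight_dualAlgHom hS z u x))) z
  exact map_convSMul E (fun a z => by
    rw [AlgHom.toLinearMap_apply, smul_eq_mul]
    exact (hleft (Algebra.lmul k R a) _).trans congr(a * $(hact z))) y

theorem isHopfModule_dual (hV : V.IsHopfAlgebra) (hS : V.IsAntipode S) :
    V.IsHopfModule (hV.dualAlgHom hS) (dualCoact k R) where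
  isLeftComodule := isLeftComodule_dualCoact k R
  coact_act y f := by
    apply (tensorDualEquivHom k R R).injective
    ext x
    rw [hV.tensorDualEquivHom_comulAct_dualAlgHom hS, tensorDualEquivHom_dualCoact,
      tensorDualEquivHom_dualCoact, hV.leftContract_dualAlgHom hS]

end IsHopfAlgebra

theorem dualCoact_eq_one_tmul_iff [FiniteDimensional k R] {f : Module.Dual k R} :
    dualCoact k R f = 1 ⊗ₜ f ↔ IsIntegral f := by
  rw [← (tensorDualEquivHom k R R).injective.eq_iff, LinearMap.ext_iff]
  simp [IsIntegral]

namespace IsHopfAlgebra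

variable [FiniteDimensional k R]

theorem exists_isIntegral_ne_zero (hV : V.IsHopfAlgebra) [Nontrivial R] :
    ∃ f : Module.Dual k R, f ≠ 0 ∧ IsIntegral f := by
  obtain ⟨S, hS⟩ := hV.exists_isAntipode
  obtain ⟨f, hf, h⟩ := (hV.isHopfModule_dual hS).exists_coinvariant_ne_zero hV hS
  exact ⟨f, hf, dualCoact_eq_one_tmul_iff.1 h⟩

theorem eq_zero_of_isIntegral_comp_dualAct (hV : V.IsHopfAlgebra) (hS : V.IsAntipode S)
    {f : Module.Dual k R} (hf0 : f ≠ 0) (hf : IsIntegral f) {y : R} (hy : f ∘ₗ V.dualAct S y = 0) :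
    y = 0 :=
  (hV.isHopfModule_dual hS).eq_zero_of_apply_coinvariant hV hS
    (dualCoact_eq_one_tmul_iff.2 hf) hf0 hy

end IsHopfAlgebra

end ActionCoaction

section Graded

open DirectSum

variable {k ι M N : Type*} [CommSemiring k] [DecidableEq ι] [AddCommMonoid M] [Module k M]
  [AddCommMonoid N] [Module k N]

theorem linearMap_ext_of_decomposition (𝒜 : ι → Submodule k M) [Decomposition 𝒜] {f g : M →ₗ[k] N}
    (h : ∀ n, ∀ x ∈ 𝒜 n, f x = g x) : f = g :=
  decompose_lhom_ext 𝒜 fun n => LinearMap.ext fun x => h n x x.2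

/-- The projection onto the component of degree `n`. -/
def homogeneousProj (𝒜 : ι → Submodule k M) [Decomposition 𝒜] (n : ι) : Module.End k M :=
  (𝒜 n).subtype ∘ₗ component k ι (fun i => 𝒜 i) n ∘ₗ (decomposeLinearEquiv 𝒜).toLinearMap

section Projection

variable (𝒜 : ι → Submodule k M) [Decomposition 𝒜] {m n : ι} {x : M}

theorem homogeneousProj_mem (n : ι) (x : M) : homogeneousProj 𝒜 n x ∈ 𝒜 n :=
  (decompose 𝒜 x n).2

theorem homogeneousProj_of_mem (hx : x ∈ 𝒜 n) : homogeneousProj 𝒜 n x = x :=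
  decompose_of_mem_same 𝒜 hx

theorem homogeneousProj_of_mem_of_ne (hx : x ∈ 𝒜 m) (hmn : m ≠ n) : homogeneousProj 𝒜 n x = 0 :=
  decompose_of_mem_ne 𝒜 hx hmn

end Projection

/-- The degree-preserving part of a linear map between graded modules. -/
def gradedPart (𝒜 : ι → Submodule k M) [Decomposition 𝒜] (ℬ : ι → Submodule k N) [Decomposition ℬ]
    (f : M →ₗ[k] N) : M →ₗ[k] N :=
  toModule k ι N (fun n => homogeneousProj ℬ n ∘ₗ f ∘ₗ (𝒜 n).subtype) ∘ₗ
    (decomposeLinearEquiv 𝒜).toLinearMap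

theorem gradedPart_of_mem {𝒜 : ι → Submodule k M} [Decomposition 𝒜] {ℬ : ι → Submodule k N}
    [Decomposition ℬ] (f : M →ₗ[k] N) {n : ι} {x : M} (hx : x ∈ 𝒜 n) :
    gradedPart 𝒜 ℬ f x = homogeneousProj ℬ n (f x) := by
  lift x to 𝒜 n using hx
  simp [gradedPart]

theorem convSMul_mem {C X A : Type*} [AddCommMonoid C] [Module k C] [AddCommMonoid X]
    [Module k X] [Semiring A] [Algebra k A] [Module A N] [IsScalarTower k A N]
    {δ : X →ₗ[k] C ⊗[k] X} {F : C →ₗ[k] A} {G : X →ₗ[k] N} {p : Submodule k X} {q : Submodule k N}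
    {x : X} (hx : δ x ∈ LinearMap.range (p.subtype.lTensor C))
    (h : ∀ c, ∀ y ∈ p, F c • G y ∈ q) : convSMul δ F G x ∈ q := by
  obtain ⟨u, hu⟩ := hx
  obtain ⟨s, hs⟩ := TensorProduct.exists_finset u
  have hδ : δ x = ∑ i ∈ s, i.1 ⊗ₜ (i.2 : X) := by simp [← hu, hs]
  rw [convSMul_apply_of_eq_sum hδ]
  exact q.sum_mem fun i _ => h i.1 i.2 i.2.2

end Graded

section GradedAlgebra

open DirectSum

variable {k ι A : Type*} [CommSemiring k] [DecidableEq ι] [Semiring A] [Algebra k A]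
  {𝒜 : ι → Submodule k A} [Decomposition 𝒜]

theorem homogeneousProj_mul_of_mem [AddRightCancelSemigroup ι] [SetLike.GradedMul 𝒜] (m : ι) {n : ι}
    (y : A) {x : A} (hx : x ∈ 𝒜 n) :
    homogeneousProj 𝒜 (m + n) (y * x) = homogeneousProj 𝒜 m y * x := by
  have h : homogeneousProj 𝒜 (m + n) ∘ₗ LinearMap.mulRight k x =
      LinearMap.mulRight k x ∘ₗ homogeneousProj 𝒜 m := by
    refine linearMap_ext_of_decomposition 𝒜 fun i y hy => ?_
    have hyx : y * x ∈ 𝒜 (i + n) := SetLike.mul_mem_graded hy hx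
    obtain rfl | him := eq_or_ne i m
    · simp [homogeneousProj_of_mem 𝒜 hy, homogeneousProj_of_mem 𝒜 hyx]
    · simp [homogeneousProj_of_mem_of_ne 𝒜 hy him,
        homogeneousProj_of_mem_of_ne 𝒜 hyx ((add_left_injective n).ne him)]
  exact congr($h y)

theorem one_mem_of_gradedMul [AddRightCancelMonoid ι] [SetLike.GradedMul 𝒜] : (1 : A) ∈ 𝒜 0 := by
  have h : LinearMap.mulLeft k (homogeneousProj 𝒜 0 1) = .id := by
    refine linearMap_ext_of_decomposition 𝒜 fun n x hx => ?_
    rw [LinearMap.mulLeft_apply, ← homogeneousProj_mul_of_mem 0 1 hx, zero_add, one_mul,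
      homogeneousProj_of_mem 𝒜 hx, LinearMap.id_apply]
  have hone : homogeneousProj 𝒜 0 1 = 1 := by simpa using congr($h 1)
  exact hone ▸ homogeneousProj_mem 𝒜 0 1

end GradedAlgebra

section GradedCoalgebra

open DirectSum Finset.HasAntidiagonal

variable {k ι C : Type*} [CommSemiring k] [AddCommMonoid C] [Module k C] [Coalgebra k C]

/-- The comultiplication of `C` respects the family `𝒜` of homogeneous components. -/
def IsGradedComul [AddMonoid ι] [Finset.HasAntidiagonal ι] (𝒜 : ι → Submodule k C) : Prop :=
  ∀ n, ∀ x ∈ 𝒜 n, comul (R := k) x ∈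
    ⨆ p ∈ antidiagonal n, LinearMap.range (TensorProduct.mapIncl (𝒜 p.1) (𝒜 p.2))

variable {𝒜 : ι → Submodule k C}

theorem IsGradedComul.apply_comul_eq_of_mem [AddMonoid ι] [Finset.HasAntidiagonal ι]
    (h𝒜 : IsGradedComul 𝒜) {X : Type*} [AddCommMonoid X] [Module k X] (f g : C ⊗[k] C →ₗ[k] X)
    {n : ι} (hfg : ∀ p q, p + q = n → ∀ a ∈ 𝒜 p, ∀ b ∈ 𝒜 q, f (a ⊗ₜ b) = g (a ⊗ₜ b)) {x : C}
    (hx : x ∈ 𝒜 n) : f (comul x) = g (comul x) := by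
  suffices h : (⨆ p ∈ antidiagonal n, LinearMap.range (TensorProduct.mapIncl (𝒜 p.1) (𝒜 p.2))) ≤
      LinearMap.eqLocus f g from h (h𝒜 n x hx)
  refine iSup₂_le fun p hp => ?_
  rintro _ ⟨u, rfl⟩
  have hp' : f ∘ₗ TensorProduct.mapIncl (𝒜 p.1) (𝒜 p.2) =
      g ∘ₗ TensorProduct.mapIncl (𝒜 p.1) (𝒜 p.2) := by
    ext a b
    exact hfg _ _ (mem_antidiagonal.1 hp) a a.2 b b.2
  exact congr($hp' u)

variable [DecidableEq ι] [AddCancelMonoid ι] [Finset.HasAntidiagonal ι] [Decomposition 𝒜]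

theorem IsGradedComul.leftContract_comp_homogeneousProj (h𝒜 : IsGradedComul 𝒜)
    (f : Module.Dual k C) {d m : ι} {x : C} (hx : x ∈ 𝒜 (d + m)) :
    leftContract k C (f ∘ₗ homogeneousProj 𝒜 d) x =
      homogeneousProj 𝒜 m (leftContract k C f x) := by
  refine h𝒜.apply_comul_eq_of_mem
    ((TensorProduct.lid k C).toLinearMap ∘ₗ (f ∘ₗ homogeneousProj 𝒜 d).rTensor C)
    (homogeneousProj 𝒜 m ∘ₗ (TensorProduct.lid k C).toLinearMap ∘ₗ f.rTensor C)
    (fun p q hpq a ha b hb => ?_) hx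
  obtain rfl | hp := eq_or_ne p d
  · obtain rfl := add_left_cancel hpq
    simp [homogeneousProj_of_mem 𝒜 ha, homogeneousProj_of_mem 𝒜 hb]
  · have hq : q ≠ m := by
      rintro rfl
      exact hp (add_right_cancel hpq)
    simp [homogeneousProj_of_mem_of_ne 𝒜 ha hp, homogeneousProj_of_mem_of_ne 𝒜 hb hq]

theorem IsGradedComul.leftContract_comp_homogeneousProj_eq_zero (h𝒜 : IsGradedComul 𝒜)
    (f : Module.Dual k C) {d n : ι} (hdn : ∀ m, d + m ≠ n) {x : C} (hx : x ∈ 𝒜 n) :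
    leftContract k C (f ∘ₗ homogeneousProj 𝒜 d) x = 0 := by
  refine h𝒜.apply_comul_eq_of_mem
    ((TensorProduct.lid k C).toLinearMap ∘ₗ (f ∘ₗ homogeneousProj 𝒜 d).rTensor C) 0
    (fun p q hpq a ha b _ => ?_) hx
  have hp : p ≠ d := by
    rintro rfl
    exact hdn q hpq
  simp [homogeneousProj_of_mem_of_ne 𝒜 ha hp]

theorem IsGradedComul.counit_comp_homogeneousProj_zero (h𝒜 : IsGradedComul 𝒜) :
    counit (R := k) ∘ₗ homogeneousProj 𝒜 0 = counit (R := k) := by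
  have hcounit : leftContract k C (counit (R := k)) = .id := by
    ext x
    simp [leftContract_apply]
  have hproj : leftContract k C (counit (R := k) ∘ₗ homogeneousProj 𝒜 0) = .id := by
    refine linearMap_ext_of_decomposition 𝒜 fun n x hx => ?_
    rw [h𝒜.leftContract_comp_homogeneousProj _ (d := 0) (m := n) (by rwa [zero_add]), hcounit]
    exact homogeneousProj_of_mem 𝒜 hx
  ext x
  rw [← counit_leftContract, hproj, LinearMap.id_apply]

theorem IsGradedComul.counit_eq_zero_of_mem (h𝒜 : IsGradedComul 𝒜) {n : ι} (hn : n ≠ 0) {x : C}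
    (hx : x ∈ 𝒜 n) : counit (R := k) x = 0 := by
  rw [← h𝒜.counit_comp_homogeneousProj_zero, LinearMap.comp_apply,
    homogeneousProj_of_mem_of_ne 𝒜 hx hn, map_zero]

end GradedCoalgebra

section GradedConvolution

open DirectSum

variable {k ι R : Type*} [CommSemiring k] [DecidableEq ι] [AddCancelMonoid ι]
  [Finset.HasAntidiagonal ι] [Semiring R] [Algebra k R] [Coalgebra k R] {𝒜 : ι → Submodule k R}
  [Decomposition 𝒜] [SetLike.GradedMul 𝒜] {S : R →ₗ[k] R}

theorem toConv_gradedPart_mul_id (h𝒜 : IsGradedComul 𝒜) (hS : toConv S * toConv .id = 1) :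
    toConv (gradedPart 𝒜 𝒜 S) * toConv .id = 1 := by
  apply WithConv.ofConv_injective
  refine linearMap_ext_of_decomposition 𝒜 fun n x hx => ?_
  calc (toConv (gradedPart 𝒜 𝒜 S) * toConv (.id : R →ₗ[k] R)) x
    _ = homogeneousProj 𝒜 n ((toConv S * toConv (.id : R →ₗ[k] R)) x) :=
      h𝒜.apply_comul_eq_of_mem
        (LinearMap.mul' k R ∘ₗ TensorProduct.map (gradedPart 𝒜 𝒜 S) .id)
        (homogeneousProj 𝒜 n ∘ₗ LinearMap.mul' k R ∘ₗ TensorProduct.map S .id)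
        (fun p q hpq a ha b hb => by
          subst hpq
          simp [gradedPart_of_mem _ ha, homogeneousProj_mul_of_mem p _ hb]) hx
    _ = counit (R := k) x • homogeneousProj 𝒜 n 1 := by
      simp [hS, Algebra.algebraMap_eq_smul_one]
    _ = algebraMap k R (counit x) := by
      obtain rfl | hn := eq_or_ne n 0
      · rw [homogeneousProj_of_mem 𝒜 one_mem_of_gradedMul, Algebra.algebraMap_eq_smul_one]
      · rw [h𝒜.counit_eq_zero_of_mem hn hx, zero_smul, map_zero]

theorem antipode_mem (h𝒜 : IsGradedComul 𝒜) (hl : toConv S * toConv .id = 1)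
    (hr : toConv .id * toConv S = 1) {n : ι} {x : R} (hx : x ∈ 𝒜 n) : S x ∈ 𝒜 n := by
  have hS : gradedPart 𝒜 𝒜 S = S :=
    WithConv.toConv_injective (left_inv_eq_right_inv (toConv_gradedPart_mul_id h𝒜 hl) hr)
  rw [← hS, gradedPart_of_mem S hx]
  exact homogeneousProj_mem 𝒜 n (S x)

end GradedConvolution

namespace ActionCoaction

variable {k H R : Type*} [Field k] [Ring H] [HopfAlgebra k H] [Ring R] [Algebra k R]
  [Coalgebra k R] {V : ActionCoaction k H R} {S : R →ₗ[k] R}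

theorem IsIntegral.comp_homogeneousProj {ι : Type*} [DecidableEq ι] [AddCancelMonoid ι]
    [Finset.HasAntidiagonal ι] {𝒜 : ι → Submodule k R} [DirectSum.Decomposition 𝒜]
    [SetLike.GradedMul 𝒜] (h𝒜 : IsGradedComul 𝒜) {f : Module.Dual k R} (hf : IsIntegral f)
    (d : ι) : IsIntegral (f ∘ₗ homogeneousProj 𝒜 d) := by
  suffices h : leftContract k R (f ∘ₗ homogeneousProj 𝒜 d) =
      LinearMap.smulRight (f ∘ₗ homogeneousProj 𝒜 d) 1 from fun x => congr($h x)
  refine linearMap_ext_of_decomposition 𝒜 fun n x hx => ?_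
  rw [LinearMap.smulRight_apply, LinearMap.comp_apply]
  by_cases hdn : ∃ m, d + m = n
  · obtain ⟨m, rfl⟩ := hdn
    rw [h𝒜.leftContract_comp_homogeneousProj f hx, hf x, map_smul]
    obtain rfl | hm := eq_or_ne m 0
    · rw [homogeneousProj_of_mem 𝒜 one_mem_of_gradedMul,
        homogeneousProj_of_mem 𝒜 (by rwa [add_zero] at hx)]
    · rw [homogeneousProj_of_mem_of_ne 𝒜 one_mem_of_gradedMul hm.symm,
        homogeneousProj_of_mem_of_ne 𝒜 hx (by simpa using hm), map_zero, smul_zero, zero_smul]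
  · push Not at hdn
    have hnd : n ≠ d := fun h => hdn 0 (by rw [add_zero, h])
    rw [h𝒜.leftContract_comp_homogeneousProj_eq_zero f hdn hx,
      homogeneousProj_of_mem_of_ne 𝒜 hx hnd, map_zero, zero_smul]

namespace IsGradedHopfAlgebra

variable {𝒜 : ℕ → Submodule k R}

theorem isGradedComul (hR : V.IsGradedHopfAlgebra 𝒜) : IsGradedComul 𝒜 :=
  hR.comul_mem

theorem gradedMul (hR : V.IsGradedHopfAlgebra 𝒜) : SetLike.GradedMul 𝒜 where
  mul_mem i j _ _ hx hy := hR.mul_mem i j _ hx _ hy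

theorem dualAct_mem (hR : V.IsGradedHopfAlgebra 𝒜) (hS : V.IsAntipode S) {i j : ℕ} {x y : R}
    (hy : y ∈ 𝒜 i) (hx : x ∈ 𝒜 j) : V.dualAct S y x ∈ 𝒜 (i + j) := by
  have := hR.gradedMul
  have := hR.isInternal.chooseDecomposition
  rw [dualAct, convSMul_apply_apply]
  refine convSMul_mem (hR.coact_mem i y hy) fun h z hz => ?_
  exact hR.act_mem _ _ _ <|
    hR.mul_mem i j _ (antipode_mem hR.isGradedComul hS.mul_id hS.id_mul hz) x hx

theorem exists_homogeneous_isIntegral [FiniteDimensional k R] [Nontrivial R]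
    (hR : V.IsGradedHopfAlgebra 𝒜) :
    ∃ (d : ℕ) (f : Module.Dual k R), f ≠ 0 ∧ IsIntegral f ∧ ∀ n ≠ d, 𝒜 n ≤ LinearMap.ker f := by
  have := hR.gradedMul
  have := hR.isInternal.chooseDecomposition
  obtain ⟨f, hf0, hf⟩ := hR.isHopfAlgebra.exists_isIntegral_ne_zero
  obtain ⟨d, hd⟩ : ∃ d, f ∘ₗ homogeneousProj 𝒜 d ≠ 0 := by
    by_contra! h
    refine hf0 (linearMap_ext_of_decomposition 𝒜 fun n x hx => ?_)
    simpa [homogeneousProj_of_mem 𝒜 hx] using congr($(h n) x)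
  refine ⟨d, _, hd, hf.comp_homogeneousProj hR.isGradedComul d, fun n hn x hx => ?_⟩
  simp [homogeneousProj_of_mem_of_ne 𝒜 hx hn]

section Pairing

variable [FiniteDimensional k R] {f : Module.Dual k R} {d : ℕ}

theorem eq_zero_of_dualAct_pairing_eq_zero (hR : V.IsGradedHopfAlgebra 𝒜) (hS : V.IsAntipode S)
    (hf0 : f ≠ 0) (hf : IsIntegral f) (hfd : ∀ n ≠ d, 𝒜 n ≤ LinearMap.ker f) {i : ℕ} {y : R}
    (hy : y ∈ 𝒜 i) (h : ∀ j, i + j = d → ∀ x ∈ 𝒜 j, f (V.dualAct S y x) = 0) : y = 0 := by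
  have := hR.isInternal.chooseDecomposition
  refine hR.isHopfAlgebra.eq_zero_of_isIntegral_comp_dualAct hS hf0 hf ?_
  refine linearMap_ext_of_decomposition 𝒜 fun j x hx => ?_
  by_cases hij : i + j = d
  · exact h j hij x hx
  · exact hfd _ hij (hR.dualAct_mem hS hy hx)

theorem finrank_le (hR : V.IsGradedHopfAlgebra 𝒜) (hf0 : f ≠ 0) (hf : IsIntegral f) {i j : ℕ}
    (hfd : ∀ n ≠ i + j, 𝒜 n ≤ LinearMap.ker f) :
    Module.finrank k (𝒜 i) ≤ Module.finrank k (𝒜 j) := by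
  obtain ⟨S, hS⟩ := hR.isHopfAlgebra.exists_isAntipode
  let pairing : 𝒜 i →ₗ[k] Module.Dual k (𝒜 j) :=
    Module.Dual.transpose (R := k) (𝒜 j).subtype ∘ₗ LinearMap.llcomp k R R k f ∘ₗ
      V.dualAct S ∘ₗ (𝒜 i).subtype
  rw [← Subspace.dual_finrank_eq (V := 𝒜 j)]
  refine LinearMap.finrank_le_finrank_of_injective (f := pairing) ?_
  rw [injective_iff_map_eq_zero]
  intro y hy
  refine Subtype.ext (hR.eq_zero_of_dualAct_pairing_eq_zero hS hf0 hf hfd y.2 fun l hl x hx => ?_)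
  obtain rfl := Nat.add_left_cancel hl
  exact congr($hy ⟨x, hx⟩)

theorem degree_eq_of_isIntegral (hR : V.IsGradedHopfAlgebra 𝒜) (hf0 : f ≠ 0)
    (hf : IsIntegral f) (hfd : ∀ n ≠ d, 𝒜 n ≤ LinearMap.ker f) {N : ℕ} (hN : 𝒜 N ≠ ⊥)
    (hgt : ∀ i, N < i → 𝒜 i = ⊥) : d = N := by
  have := hR.isInternal.chooseDecomposition
  obtain ⟨S, hS⟩ := hR.isHopfAlgebra.exists_isAntipode
  obtain ⟨z, hz, hz0⟩ := (Submodule.ne_bot_iff _).1 hN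
  apply le_antisymm
  · by_contra! h
    refine hf0 (linearMap_ext_of_decomposition 𝒜 fun n x hx => ?_)
    obtain rfl | hn := eq_or_ne n d
    · rw [hgt n h, Submodule.mem_bot] at hx
      rw [hx, map_zero, map_zero]
    · exact hfd n hn hx
  · by_contra! h
    exact hz0 (hR.eq_zero_of_dualAct_pairing_eq_zero hS hf0 hf hfd hz
      fun j hj => absurd hj (by omega))

end Pairing

end IsGradedHopfAlgebra

end ActionCoaction

end

theorem mainTheorem4_general {k H R : Type*} [Field k] [Ring H] [HopfAlgebra k H]
    [Ring R] [Algebra k R] [Coalgebra k R] [FiniteDimensional k R]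
    (V : ActionCoaction k H R) (𝒜 : ℕ → Submodule k R) (hR : V.IsGradedHopfAlgebra 𝒜)
    (N : ℕ) (hN : 𝒜 N ≠ ⊥) (hgt : ∀ i, N < i → 𝒜 i = ⊥) :
    ∀ i ≤ N, Module.finrank k (𝒜 i) = Module.finrank k (𝒜 (N - i)) := by
  have : Nontrivial R :=
    (subsingleton_or_nontrivial R).resolve_left fun _ => hN (Subsingleton.elim _ _)
  obtain ⟨d, f, hf0, hf, hfd⟩ := hR.exists_homogeneous_isIntegral
  obtain rfl : d = N := hR.degree_eq_of_isIntegral hf0 hf hfd hN hgt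
  intro i hi
  apply le_antisymm
  · exact hR.finrank_le hf0 hf (by rwa [Nat.add_sub_cancel' hi])
  · exact hR.finrank_le hf0 hf (by rwa [Nat.sub_add_cancel hi])

theorem mainTheorem4 {k H R : Type*} [Field k] [Ring H] [HopfAlgebra k H]
    (hS : Function.Bijective (HopfAlgebra.antipode k : H →ₗ[k] H))
    [Ring R] [Algebra k R] [Coalgebra k R] [FiniteDimensional k R]
    (V : ActionCoaction k H R) (𝒜 : ℕ → Submodule k R) (hR : V.IsGradedHopfAlgebra 𝒜)
    (N : ℕ) (hN : 𝒜 N ≠ ⊥) (hgt : ∀ i, N < i → 𝒜 i = ⊥) :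
    ∀ i ≤ N, Module.finrank k (𝒜 i) = Module.finrank k (𝒜 (N - i)) :=
  mainTheorem4_general V 𝒜 hR N hN hgt
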